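/- Let $D(n)$ be the set of positive definite Hermitian $n\times n$ complex matrices of trace one. It is an open subset of the real affine space of Hermitian matrices of trace one, so its tangent space at every point is the space of traceless Hermitian matrices. Equip it with the Bures–Wasserstein metric $$\mathfrak g^{BW}_\rho(H,K)=\tfrac12\,\mathrm{Re}\,\mathrm{tr}\big(\mathcal L_\rho(H)K\big),$$ where $\mathcal L_\rho(H)$ is the unique solution $X$ of $\rho X+X\rho=H$. Let $\pi(M)=MM^*$, let $\|A\|_2=(\mathrm{tr}\,AA^*)^{1/2}$, and let $\mathbb S_{GL(n)}=\{A\in GL(n):\|A\|_2=1\}$ carry the metric $\mathrm{Re}\,\mathrm{tr}(AB^*)$. An unnormalised geodesic between two points is a curve parametrised by $[0,1]$ from one to the other of the form $\sigma\circ\varphi$, where $\sigma:[0,1]\to D(n)$ is a smooth geodesic of the Levi-Civita connection and $\varphi:[0,1]\to[0,1]$ is smooth with $\varphi(0)=0$, $\varphi(1)=1$ and $\varphi'>0$. **Theorem.** Let $\rho_1,\rho_2\in D(n)$ and, for $t\in\mathbb R$, let $$\gamma(t)=(1-t)\rho_1^{1/2}+t\,\rho_2^{1/2}U,\qquad \tilde\gamma(t)=\frac{\gamma(t)}{\|\gamma(t)\|_2},$$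 where $U=(NN^*)^{-1/2}N$ is the unitary polar factor of $N=\rho_2^{1/2}\rho_1^{1/2}$. Then: 1. $t\mapsto\pi(\tilde\gamma(t))$, $t\in[0,1]$, is an unnormalised geodesic between $\rho_1$ and $\rho_2$ in $(D(n),\mathfrak g^{BW})$; 2. for every $t\in[0,1]$, $\gamma(t)\neq0$ and $\tilde\gamma(t)\in\mathbb S_{GL(n)}$; 3. $\tilde\gamma$ is differentiable at $0$ and $\tilde\gamma'(0)$ is horizontal for $\pi:\mathbb S_{GL(n)}\to D(n)$, i.e. it is tangent to $\mathbb S_{GL(n)}$ at $\rho_1^{1/2}$ and orthogonal, for $\mathrm{Re}\,\mathrm{tr}(AB^*)$, to every vector tangent to $\mathbb S_{GL(n)}$ at $\rho_1^{1/2}$ that lies in the kernel of $d\pi_{\rho_1^{1/2}}$. -/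

import Mathlib

open scoped ComplexOrder MatrixOrder ContDiff

namespace BuresWasserstein

/-- Complex `n × n` matrices. -/
abbrev Mat (n : ℕ) : Type := Matrix (Fin n) (Fin n) ℂ

/-- The positive semidefinite square root `A^{1/2}`. -/
noncomputable def msqrt {n : ℕ} (A : Mat n) : Mat n := CFC.sqrt A

/-- The unitary polar factor `U = (N N*)^{-1/2} N` of an invertible matrix `N`
(so that `N = (N N*)^{1/2} U`). -/
noncomputable def polarFactor {n : ℕ} (N : Mat n) : Mat n :=
  (msqrt (N * N.conjTranspose))⁻¹ * N

/-- The set `D(n)` of positive definite Hermitian matrices of trace one. -/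
def densities (n : ℕ) : Set (Mat n) := {ρ | ρ.PosDef ∧ ρ.trace = 1}

/-- The tangent space of `D(n)` at any point: traceless Hermitian matrices. -/
def densityTangent (n : ℕ) : Submodule ℝ (Mat n) where
  carrier := {H | H.IsHermitian ∧ H.trace = 0}
  add_mem' := fun ha hb => ⟨ha.1.add hb.1, by rw [Matrix.trace_add, ha.2, hb.2, add_zero]⟩
  zero_mem' := ⟨Matrix.isHermitian_zero, Matrix.trace_zero _ _⟩
  smul_mem' := fun c A hA => ⟨by
      have h : A.conjTranspose = A := hA.1
      change (c • A).conjTranspose = c • A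
      rw [Matrix.conjTranspose_smul, h, star_trivial],
    by rw [Matrix.trace_smul, hA.2, smul_zero]⟩

/-- For positive definite `S` the Lyapunov equation `S X + X S = H` has exactly one solution. -/
theorem existsUnique_lyapunov {n : ℕ} {S : Mat n} (hS : S.PosDef) (H : Mat n) :
    ∃! X : Mat n, S * X + X * S = H := by
  let T : Mat n →ₗ[ℂ] Mat n := LinearMap.mulLeft ℂ S + LinearMap.mulRight ℂ S
  have hinj : Function.Injective T := by
    rw [← LinearMap.ker_eq_bot, LinearMap.ker_eq_bot']
    intro X hX
    have hX : S * X + X * S = 0 := hX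
    have h1 : (X.conjTranspose * S * X).PosSemidef :=
      hS.posSemidef.conjTranspose_mul_mul_same X
    have h2 : (X * S * X.conjTranspose).PosSemidef :=
      hS.posSemidef.mul_mul_conjTranspose_same X
    have h0 : (X.conjTranspose * S * X).trace + (X * S * X.conjTranspose).trace = 0 := by
      rw [Matrix.trace_mul_comm (X * S), ← Matrix.trace_add, Matrix.mul_assoc, ← Matrix.mul_add,
        hX, Matrix.mul_zero, Matrix.trace_zero]
    have h3 : (X.conjTranspose * S * X).trace = 0 :=
      ((add_eq_zero_iff_of_nonneg h1.trace_nonneg h2.trace_nonneg).1 h0).1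
    have h4 : X.conjTranspose * S * X = 0 := h1.trace_eq_zero_iff.1 h3
    by_contra hne
    apply hne
    ext i j
    have h5 : star (X.mulVec (Pi.single j 1)) ⬝ᵥ S.mulVec (X.mulVec (Pi.single j 1)) = 0 := by
      rw [Matrix.star_mulVec, ← Matrix.dotProduct_mulVec, Matrix.mulVec_mulVec,
        Matrix.mulVec_mulVec, h4, Matrix.zero_mulVec, dotProduct_zero]
    have h6 : X.mulVec (Pi.single j 1) = 0 := by
      by_contra hv
      exact (hS.dotProduct_mulVec_pos hv).ne' h5
    have h7 := congrFun h6 i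
    simpa using h7
  have hsurj : Function.Surjective T := LinearMap.surjective_of_injective hinj
  obtain ⟨X, hX⟩ := hsurj H
  exact ⟨X, hX, fun Y hY => hinj (hY.trans hX.symm)⟩

/-- The solution `X = L_S(H)` of the Lyapunov equation `S X + X S = H`. -/
noncomputable def lyapunov {n : ℕ} (S H : Mat n) : Mat n :=
  Classical.epsilon fun X => S * X + X * S = H

theorem lyapunov_spec {n : ℕ} {S : Mat n} (hS : S.PosDef) (H : Mat n) :
    S * lyapunov S H + lyapunov S H * S = H :=
  Classical.epsilon_spec (existsUnique_lyapunov hS H).exists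

/-- The Bures-Wasserstein metric `g_S(H, K) = (1/2) Re tr (L_S(H) K)`. -/
noncomputable def bwMetric {n : ℕ} (S H K : Mat n) : ℝ :=
  (1 / 2) * (lyapunov S H * K).trace.re

/-- The map `π(M) = M M*`. -/
def bwProj {n : ℕ} (M : Mat n) : Mat n := M * M.conjTranspose

/-! From here on, matrices carry the Frobenius norm `‖A‖₂ = (tr (A A*))^{1/2}`. -/

attribute [local instance] Matrix.frobeniusNormedAddCommGroup Matrix.frobeniusNormedSpace

/-- Sanity check: the norm used below is `(tr (A A*))^{1/2}`. -/
theorem norm_eq_sqrt_trace {n : ℕ} (A : Mat n) :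
    ‖A‖ = Real.sqrt (A * A.conjTranspose).trace.re := by
  rw [Matrix.frobenius_norm_def, Real.sqrt_eq_rpow]
  congr 1
  simp only [Matrix.trace, Matrix.diag, Matrix.mul_apply, Complex.re_sum,
    Matrix.conjTranspose_apply]
  refine Finset.sum_congr rfl fun i _ => Finset.sum_congr rfl fun j _ => ?_
  rw [RCLike.star_def, Complex.mul_conj, Complex.ofReal_re, Complex.normSq_eq_norm_sq]
  norm_cast

/-- `Γ_p(X, Y, Z) = (1/2) (∂_X g(Y, Z) + ∂_Y g(X, Z) - ∂_Z g(X, Y))` at `p`. By the Koszul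
formula this is `g_p(∇_X Y, Z)` for constant (hence commuting) vector fields `X, Y, Z`, where
`∇` is the Levi-Civita connection of `g` (the Christoffel symbol of the first kind). -/
noncomputable def christoffel {E : Type*} [AddCommGroup E] [Module ℝ E]
    (g : E → E → E → ℝ) (p X Y Z : E) : ℝ :=
  (1 / 2) * (deriv (fun s : ℝ => g (p + s • X) Y Z) 0
    + deriv (fun s : ℝ => g (p + s • Y) X Z) 0
    - deriv (fun s : ℝ => g (p + s • Z) X Y) 0)

/-- `σ : [0, 1] → M` is a geodesic of `(M, g)`, where `M` is an open subset of an affine subspace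
of `E` with direction `T` (so that `T` is the tangent space at every point), and `g` is a
Riemannian metric on `M`: the curve is smooth and its covariant acceleration vanishes,
`g(∇_{σ'} σ', Z) = g(σ'', Z) + Γ(σ', σ', Z) = 0` for every tangent vector `Z`. -/
def IsGeodesic {E : Type*} [NormedAddCommGroup E] [NormedSpace ℝ E]
    (M : Set E) (T : Submodule ℝ E) (g : E → E → E → ℝ) (σ : ℝ → E) : Prop :=
  ContDiffOn ℝ ∞ σ (Set.Icc 0 1) ∧
  (∀ t ∈ Set.Icc (0 : ℝ) 1, σ t ∈ M) ∧
  ∀ t ∈ Set.Icc (0 : ℝ) 1, ∀ Z ∈ T,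
    g (σ t) (derivWithin (derivWithin σ (Set.Icc 0 1)) (Set.Icc 0 1) t) Z
      + christoffel g (σ t) (derivWithin σ (Set.Icc 0 1) t) (derivWithin σ (Set.Icc 0 1) t) Z = 0

/-- An unnormalised geodesic between `p` and `q`: a curve `c : [0, 1] → M` from `p` to `q` that is
a smooth regular increasing reparametrisation of a geodesic. -/
def IsUnnormalisedGeodesicBetween {E : Type*} [NormedAddCommGroup E] [NormedSpace ℝ E]
    (M : Set E) (T : Submodule ℝ E) (g : E → E → E → ℝ) (p q : E) (c : ℝ → E) : Prop :=
  c 0 = p ∧ c 1 = q ∧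
  ∃ (σ : ℝ → E) (φ : ℝ → ℝ), IsGeodesic M T g σ ∧
    ContDiffOn ℝ ∞ φ (Set.Icc 0 1) ∧ φ 0 = 0 ∧ φ 1 = 1 ∧
    (∀ t ∈ Set.Icc (0 : ℝ) 1, 0 < derivWithin φ (Set.Icc 0 1) t) ∧
    ∀ t ∈ Set.Icc (0 : ℝ) 1, c t = σ (φ t)

/-- `c` is an unnormalised geodesic between `ρ₁` and `ρ₂` in `D(n)` with the Bures-Wasserstein
metric; `D(n)` is open in the affine space of Hermitian matrices of trace one. -/
def IsUnnormalisedBWGeodesic {n : ℕ} (ρ₁ ρ₂ : Mat n) (c : ℝ → Mat n) : Prop :=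
  IsUnnormalisedGeodesicBetween (densities n) (densityTangent n) bwMetric ρ₁ ρ₂ c

/-- The unit sphere `{A : tr (A A*) = 1}` of the matrix space, intersected with `GL(n)`. -/
def unitSphereGL (n : ℕ) : Set (Mat n) := {A | ‖A‖ = 1 ∧ IsUnit A}

/-- `A` is a horizontal tangent vector at `M` of the submersion `π` from the unit sphere in
`GL(n)`, with the metric `Re tr (A B*)`, onto `D(n)`: it is tangent to the sphere, and orthogonal
to all tangent vectors in the kernel of the differential of `π`. -/
def IsHorizontal {n : ℕ} (M A : Mat n) : Prop :=
  (A * M.conjTranspose).trace.re = 0 ∧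
  ∀ K : Mat n, (K * M.conjTranspose).trace.re = 0 → fderiv ℝ (bwProj (n := n)) M K = 0 →
    (A * K.conjTranspose).trace.re = 0

/-- The curve `c` is differentiable at `0` and its velocity there is horizontal at `c 0`. -/
def StartsHorizontally {n : ℕ} (c : ℝ → Mat n) : Prop :=
  DifferentiableAt ℝ c 0 ∧ IsHorizontal (c 0) (deriv c 0)

/-- The segment `γ(t) = (1 - t) ρ₁^{1/2} + t ρ₂^{1/2} U`, with `U` the unitary polar factor of
`ρ₂^{1/2} ρ₁^{1/2}`. -/
noncomputable def segment {n : ℕ} (ρ₁ ρ₂ : Mat n) (t : ℝ) : Mat n :=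
  (1 - t) • msqrt ρ₁ + t • (msqrt ρ₂ * polarFactor (msqrt ρ₂ * msqrt ρ₁))

/-- The normalised curve `γ(t) / ‖γ(t)‖₂`. -/
noncomputable def normalisedSegment {n : ℕ} (ρ₁ ρ₂ : Mat n) (t : ℝ) : Mat n :=
  ‖segment ρ₁ ρ₂ t‖⁻¹ • segment ρ₁ ρ₂ t

end BuresWasserstein

/-! Put `A = ρ₁^{1/2}` and `B = ρ₂^{1/2} U`, unit vectors with `π(A) = ρ₁` and `π(B) = ρ₂`. The
polar factor is chosen so that `A * B = N* U` is positive definite (`posDef_msqrt_mul_lift`), and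
everything follows from this. Nontrivial nonnegative combinations of `A` and `B` are invertible. If
`C`, `D` are real combinations of `A` and `B`, then `C* D` is Hermitian, so for invertible `C` one
has `D = X C` with `X` Hermitian, which is horizontality at `C`. Finally `Re tr (A B*) > 0`, so `A`
and `B` meet at an angle `θ < π/2`.

The normalised chord runs along the great circle arc from `A` to `B` (`normalised_chord_eq_arc`),
and the arc projects to a geodesic (`isGeodesic_bwProj_arc`). The latter is a direct check of the
geodesic equation: with `S = C C*` and `C' = X C`, one has `S' = X S + S X` and `S'' = -2θ² S + 2 X
S X`. The Christoffel symbol comes from differentiating the Lyapunov equation in `S`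
(`hasDerivAt_lyapunov`), and the terms cancel in `bwMetric_add_christoffel_eq_zero`. If `A = B`, the
geodesic is constant. -/

namespace BuresWasserstein

open scoped Matrix

/-! ### Polar factors, the optimal lift, and the pencil of real combinations of two lifts -/

section Algebra

variable {n : ℕ}

theorem msqrt_mul_self {A : Mat n} (hA : A.PosSemidef) : msqrt A * msqrt A = A :=
  CFC.sqrt_mul_sqrt_self A hA.nonneg

theorem posDef_msqrt {A : Mat n} (hA : A.PosDef) : (msqrt A).PosDef :=
  Matrix.isStrictlyPositive_iff_posDef.1 hA.isStrictlyPositive.sqrt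

theorem posDef_mul_conjTranspose {M : Mat n} (hM : IsUnit M) : (M * Mᴴ).PosDef := by
  refine (Matrix.posSemidef_self_mul_conjTranspose M).posDef_iff_isUnit.2 (hM.mul ?_)
  exact hM.star

theorem posDef_msqrt_mul_conjTranspose {N : Mat n} (hN : IsUnit N) :
    (msqrt (N * Nᴴ)).PosDef :=
  posDef_msqrt (posDef_mul_conjTranspose hN)

theorem msqrt_mul_polarFactor {N : Mat n} (hN : IsUnit N) :
    msqrt (N * Nᴴ) * polarFactor N = N := by
  rw [polarFactor, ← Matrix.mul_assoc, Matrix.mul_nonsing_inv _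
    ((Matrix.isUnit_iff_isUnit_det _).1 (posDef_msqrt_mul_conjTranspose hN).isUnit),
    Matrix.one_mul]

theorem polarFactor_mul_conjTranspose {N : Mat n} (hN : IsUnit N) :
    polarFactor N * (polarFactor N)ᴴ = 1 := by
  have hR := posDef_msqrt_mul_conjTranspose hN
  have hdet := (Matrix.isUnit_iff_isUnit_det _).1 hR.isUnit
  have hsq := msqrt_mul_self (posDef_mul_conjTranspose hN).posSemidef
  rw [polarFactor, Matrix.conjTranspose_mul, Matrix.conjTranspose_nonsing_inv, hR.isHermitian.eq]
  generalize msqrt (N * Nᴴ) = R at *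
  calc R⁻¹ * N * (Nᴴ * R⁻¹) = R⁻¹ * (N * Nᴴ) * R⁻¹ := by simp only [Matrix.mul_assoc]
    _ = (R⁻¹ * R) * (R * R⁻¹) := by rw [← hsq]; simp only [Matrix.mul_assoc]
    _ = 1 := by rw [Matrix.nonsing_inv_mul _ hdet, Matrix.mul_nonsing_inv _ hdet, one_mul]

theorem isUnit_polarFactor {N : Mat n} (hN : IsUnit N) : IsUnit (polarFactor N) :=
  IsUnit.of_mul_eq_one _ (polarFactor_mul_conjTranspose hN)

/-- Substituting `N = R U` with `R = (N N*)^{1/2}` gives `N* U = U* R U`, a congruence of `R`. -/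
theorem posDef_conjTranspose_mul_polarFactor {N : Mat n} (hN : IsUnit N) :
    (Nᴴ * polarFactor N).PosDef := by
  have hR := posDef_msqrt_mul_conjTranspose hN
  have h : Nᴴ * polarFactor N =
      (polarFactor N)ᴴ * msqrt (N * Nᴴ) * polarFactor N := by
    conv_lhs => rw [← msqrt_mul_polarFactor hN, Matrix.conjTranspose_mul, hR.isHermitian.eq]
    rw [msqrt_mul_polarFactor hN]
  rw [h]
  exact hR.conjTranspose_mul_mul_same
    (Matrix.mulVec_injective_of_isUnit (isUnit_polarFactor hN))

/-- `ρ₂^{1/2} U` is the optimal lift of `ρ₂` relative to the lift `ρ₁^{1/2}` of `ρ₁`. -/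
theorem posDef_msqrt_mul_lift {ρ₁ ρ₂ : Mat n} (h₁ : ρ₁.PosDef) (h₂ : ρ₂.PosDef) :
    (msqrt ρ₁ * (msqrt ρ₂ * polarFactor (msqrt ρ₂ * msqrt ρ₁))).PosDef := by
  have hN : IsUnit (msqrt ρ₂ * msqrt ρ₁) :=
    (posDef_msqrt h₂).isUnit.mul (posDef_msqrt h₁).isUnit
  have h := posDef_conjTranspose_mul_polarFactor hN
  rwa [Matrix.conjTranspose_mul, (posDef_msqrt h₁).isHermitian.eq,
    (posDef_msqrt h₂).isHermitian.eq, Matrix.mul_assoc] at h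

theorem bwProj_msqrt {ρ : Mat n} (h : ρ.PosDef) : bwProj (msqrt ρ) = ρ := by
  rw [bwProj, (posDef_msqrt h).isHermitian.eq, msqrt_mul_self h.posSemidef]

theorem bwProj_lift {ρ₁ ρ₂ : Mat n} (h₁ : ρ₁.PosDef) (h₂ : ρ₂.PosDef) :
    bwProj (msqrt ρ₂ * polarFactor (msqrt ρ₂ * msqrt ρ₁)) = ρ₂ := by
  have hN : IsUnit (msqrt ρ₂ * msqrt ρ₁) :=
    (posDef_msqrt h₂).isUnit.mul (posDef_msqrt h₁).isUnit
  rw [bwProj, Matrix.conjTranspose_mul, Matrix.mul_assoc, ← Matrix.mul_assoc (polarFactor _),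
    polarFactor_mul_conjTranspose hN, Matrix.one_mul, (posDef_msqrt h₂).isHermitian.eq,
    msqrt_mul_self h₂.posSemidef]

/-- Left multiplication by `A` turns the combination into `a A² + b A B`, a positive definite
matrix. -/
theorem isUnit_smul_add_smul {A B : Mat n} (hA : A.PosDef) (hAB : (A * B).PosDef) {a b : ℝ}
    (ha : 0 ≤ a) (hb : 0 ≤ b) (hab : 0 < a + b) : IsUnit (a • A + b • B) := by
  have hAA : (A * A).PosDef := by
    have := posDef_mul_conjTranspose hA.isUnit
    rwa [hA.isHermitian.eq] at this
  have h : (A * (a • A + b • B)).PosDef := by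
    rw [Matrix.mul_add, Matrix.mul_smul, Matrix.mul_smul]
    rcases ha.eq_or_lt with rfl | ha
    · rw [zero_smul, zero_add]
      exact hAB.smul (by linarith)
    · exact (hAA.smul ha).add_posSemidef (hAB.posSemidef.smul hb)
  exact (hA.isUnit.mul_left_iff).1 h.isUnit

/-- Since `B* A = A B`, the product expands in the Hermitian matrices `A²`, `A B`, `B* B` with real
coefficients symmetric under exchanging `(a, b)` and `(c, d)`. -/
theorem isHermitian_conjTranspose_mul_pencil {A B : Mat n} (hA : A.IsHermitian)
    (hAB : (A * B).IsHermitian) (a b c d : ℝ) :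
    ((a • A + b • B)ᴴ * (c • A + d • B)).IsHermitian := by
  have h : Bᴴ * A = A * B := by
    have := hAB.eq
    rwa [Matrix.conjTranspose_mul, hA.eq] at this
  have e : ∀ a b c d : ℝ, (a • A + b • B)ᴴ * (c • A + d • B) =
      (a * c) • (A * A) + (a * d + b * c) • (A * B) + (b * d) • (Bᴴ * B) := by
    intro a b c d
    simp only [Matrix.conjTranspose_add, Matrix.conjTranspose_smul, star_trivial, hA.eq,
      Matrix.add_mul, Matrix.mul_add, Matrix.smul_mul, Matrix.mul_smul, h, smul_smul, smul_add]
    module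
  have e' := e c d a b
  rw [Matrix.IsHermitian, Matrix.conjTranspose_mul, Matrix.conjTranspose_conjTranspose, e, e]
  module

/-- `D C⁻¹ = (C*)⁻¹ (C* D) C⁻¹` is a congruence of `C* D`. For `D` the velocity at `C`, it supplies
the Hermitian `X` with `D = X C`. -/
theorem isHermitian_mul_inv {C D : Mat n} (hC : IsUnit C) (h : (Cᴴ * D).IsHermitian) :
    (D * C⁻¹).IsHermitian := by
  have hd := (Matrix.isUnit_iff_isUnit_det _).1 hC
  have hd' : IsUnit (Cᴴ).det := (Matrix.isUnit_iff_isUnit_det _).1 hC.star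
  have h' : Dᴴ * C = Cᴴ * D := by
    have := h.eq
    rwa [Matrix.conjTranspose_mul, Matrix.conjTranspose_conjTranspose] at this
  rw [Matrix.IsHermitian, Matrix.conjTranspose_mul, Matrix.conjTranspose_nonsing_inv]
  calc (Cᴴ)⁻¹ * Dᴴ = (Cᴴ)⁻¹ * (Dᴴ * C) * C⁻¹ := by
        rw [Matrix.mul_assoc, Matrix.mul_assoc, Matrix.mul_nonsing_inv _ hd, Matrix.mul_one]
    _ = D * C⁻¹ := by rw [h', ← Matrix.mul_assoc, Matrix.nonsing_inv_mul _ hd', Matrix.one_mul]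

end Algebra

/-! ### Algebra of the Lyapunov operator -/

section Lyapunov

variable {n : ℕ} {S : Mat n}

theorem lyapunov_eq_of (hS : S.PosDef) {H X : Mat n} (h : S * X + X * S = H) :
    lyapunov S H = X :=
  (existsUnique_lyapunov hS H).unique (lyapunov_spec hS H) h

/-- Symmetry of the metric: the Lyapunov operator is self-adjoint for the trace pairing by
cyclicity. -/
theorem trace_lyapunov_mul_comm (hS : S.PosDef) (H K : Mat n) :
    (lyapunov S H * K).trace = (lyapunov S K * H).trace := by
  have hH := lyapunov_spec hS H
  have hK := lyapunov_spec hS K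
  generalize lyapunov S H = X at *
  generalize lyapunov S K = Y at *
  rw [← hH, ← hK]
  have h1 : (X * (S * Y)).trace = (Y * (X * S)).trace := by
    rw [← Matrix.mul_assoc, Matrix.trace_mul_comm (X * S)]
  have h2 : (X * (Y * S)).trace = (Y * (S * X)).trace := by
    rw [Matrix.trace_mul_comm, Matrix.mul_assoc]
  rw [Matrix.mul_add, Matrix.mul_add, Matrix.trace_add, Matrix.trace_add, h1, h2, add_comm]

theorem lyapunov_add (hS : S.PosDef) (H K : Mat n) :
    lyapunov S (H + K) = lyapunov S H + lyapunov S K := by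
  refine lyapunov_eq_of hS ?_
  conv_rhs => rw [← lyapunov_spec hS H, ← lyapunov_spec hS K]
  noncomm_ring

theorem lyapunov_neg (hS : S.PosDef) (H : Mat n) : lyapunov S (-H) = -lyapunov S H := by
  refine lyapunov_eq_of hS ?_
  conv_rhs => rw [← lyapunov_spec hS H]
  noncomm_ring

end Lyapunov

/-! ### Differentiating the solution of a linear equation with respect to a parameter -/

section FiniteDimensional

variable {E F : Type*} [NormedAddCommGroup E] [NormedSpace ℝ E] [FiniteDimensional ℝ E]
  [NormedAddCommGroup F] [NormedSpace ℝ F]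

theorem hasDerivAt_linearMap_comp (L : E →ₗ[ℝ] F) {f : ℝ → E} {f' : E} {t : ℝ}
    (hf : HasDerivAt f f' t) : HasDerivAt (fun s => L (f s)) (L f') t :=
  (LinearMap.toContinuousLinearMap L).hasFDerivAt.comp_hasDerivAt t hf

theorem contDiff_linearMap (L : E →ₗ[ℝ] F) : ContDiff ℝ ∞ L :=
  (LinearMap.toContinuousLinearMap L).contDiff

/-- A solution `f s` of the linear equation `(T₀ + s T₁) (f s) = y` is differentiable at `0`
if `T₀` is bijective. -/
theorem exists_hasDerivAt_linear_solution (T₀ T₁ : E →ₗ[ℝ] E) (hT₀ : Function.Bijective T₀)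
    -- The equation is demanded only where it is solvable, because `lyapunov` is a choice with no
    -- meaning elsewhere.
    {f : ℝ → E} {y : E}
    (hf : ∀ s : ℝ, (∃ x, T₀ x + s • T₁ x = y) → T₀ (f s) + s • T₁ (f s) = y) :
    ∃ f', HasDerivAt f f' 0 ∧ T₀ f' + T₁ (f 0) = 0 := by
  let A := LinearMap.toContinuousLinearMap T₀
  let B := LinearMap.toContinuousLinearMap T₁
  have : CompleteSpace E := FiniteDimensional.complete ℝ E
  have hT : HasDerivAt (fun s : ℝ => A + s • B) B 0 := by
    simpa using ((hasDerivAt_id (0 : ℝ)).smul_const B).const_add A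
  have hu : IsUnit (A + (0 : ℝ) • B) := by
    rw [zero_smul, add_zero, ContinuousLinearMap.isUnit_iff_bijective]
    exact hT₀
  -- Invertibility is an open condition, so near `0` the function `f` is the inverse operator
  -- applied to `y`.
  have hev : ∀ᶠ s in nhds (0 : ℝ), IsUnit (A + s • B) :=
    hT.continuousAt.eventually (Units.isOpen.mem_nhds hu)
  have hinv : ∀ s : ℝ, IsUnit (A + s • B) → f s = Ring.inverse (A + s • B) y := by
    intro s hs
    have h1 : (A + s • B) (Ring.inverse (A + s • B) y) = y :=
      congrArg (fun T : E →L[ℝ] E => T y) (Ring.mul_inverse_cancel _ hs)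
    have h2 : (A + s • B) (f s) = y := hf s ⟨_, h1⟩
    exact (ContinuousLinearMap.isUnit_iff_bijective.1 hs).1 (h2.trans h1.symm)
  have hdiff : DifferentiableAt ℝ f 0 := by
    have h1 : DifferentiableAt ℝ (fun s : ℝ => Ring.inverse (A + s • B) y) 0 :=
      (hT.differentiableAt.inverse hu).clm_apply (differentiableAt_const y)
    exact h1.congr_of_eventuallyEq (hev.mono hinv)
  refine ⟨_, hdiff.hasDerivAt, ?_⟩
  -- The product rule is compared with the derivative of the constant `y`.
  have hsum := hT.clm_apply hdiff.hasDerivAt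
  have hconst : HasDerivAt (fun s : ℝ => (A + s • B) (f s)) 0 0 := by
    refine (hasDerivAt_const (0 : ℝ) y).congr_of_eventuallyEq ?_
    filter_upwards [hev] with s hs
    rw [hinv s hs]
    exact congrArg (fun T : E →L[ℝ] E => T y) (Ring.mul_inverse_cancel _ hs)
  have key := hsum.unique hconst
  rw [zero_smul, add_zero, add_comm] at key
  exact key

end FiniteDimensional

attribute [local instance] Matrix.frobeniusNormedAddCommGroup Matrix.frobeniusNormedSpace

/-! ### Derivatives of the projection and of the metric; the covariant acceleration -/

section Calculus

variable {n : ℕ}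

theorem hasDerivAt_matrix_mul {f g : ℝ → Mat n} {f' g' : Mat n} {t : ℝ} (hf : HasDerivAt f f' t)
    (hg : HasDerivAt g g' t) : HasDerivAt (fun s => f s * g s) (f' * g t + f t * g') t := by
  let := Matrix.frobeniusNormedRing (m := Fin n) (α := ℂ)
  let := Matrix.frobeniusNormedAlgebra (m := Fin n) (R := ℝ) (α := ℂ)
  exact hf.mul hg

/-- The conjugate transpose as a real-linear map. -/
noncomputable def conjTransposeLM (n : ℕ) : Mat n →ₗ[ℝ] Mat n where
  toFun := fun M => Mᴴ
  map_add' := Matrix.conjTranspose_add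
  map_smul' := fun c M => by simp

theorem hasDerivAt_conjTranspose {f : ℝ → Mat n} {f' : Mat n} {t : ℝ} (hf : HasDerivAt f f' t) :
    HasDerivAt (fun s => (f s)ᴴ) f'ᴴ t :=
  hasDerivAt_linearMap_comp (conjTransposeLM n) hf

theorem hasDerivAt_bwProj_comp {f : ℝ → Mat n} {f' : Mat n} {t : ℝ} (hf : HasDerivAt f f' t) :
    HasDerivAt (fun s => bwProj (f s)) (f' * (f t)ᴴ + f t * f'ᴴ) t :=
  hasDerivAt_matrix_mul hf (hasDerivAt_conjTranspose hf)

theorem contDiff_bwProj : ContDiff ℝ ∞ (bwProj (n := n)) := by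
  let := Matrix.frobeniusNormedRing (m := Fin n) (α := ℂ)
  let := Matrix.frobeniusNormedAlgebra (m := Fin n) (R := ℝ) (α := ℂ)
  exact contDiff_id.mul (contDiff_linearMap (conjTransposeLM n))

theorem hasDerivAt_add_smul (M K : Mat n) (t : ℝ) : HasDerivAt (fun s : ℝ => M + s • K) K t := by
  have h := ((hasDerivAt_id t).smul_const K).const_add M
  rw [one_smul] at h
  exact h

theorem fderiv_bwProj_apply (M K : Mat n) :
    fderiv ℝ (bwProj (n := n)) M K = K * Mᴴ + M * Kᴴ := by
  have h1 := hasDerivAt_add_smul M K 0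
  have h2 := hasDerivAt_bwProj_comp h1
  have hd : DifferentiableAt ℝ (bwProj (n := n)) M :=
    contDiff_bwProj.differentiable (by simp) M
  have h3 : HasDerivAt (fun s : ℝ => bwProj (M + s • K)) (fderiv ℝ (bwProj (n := n)) M K) 0 := by
    have : HasFDerivAt (bwProj (n := n)) (fderiv ℝ (bwProj (n := n)) M) (M + (0 : ℝ) • K) := by
      simpa using hd.hasFDerivAt
    exact this.comp_hasDerivAt 0 h1
  simpa using h3.unique h2

/-- The linear map `X ↦ S X + X S`. -/
noncomputable def lyapunovLM (S : Mat n) : Mat n →ₗ[ℝ] Mat n :=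
  LinearMap.mulLeft ℝ S + LinearMap.mulRight ℝ S

theorem lyapunovLM_apply (S X : Mat n) : lyapunovLM S X = S * X + X * S := rfl

/-- Differentiating `(S + s W) X(s) + X(s) (S + s W) = H` at `0` gives `S X' + X' S = -(W X + X W)`.
As `W` is arbitrary, `S + s W` need not be Hermitian, so solvability near `0` rests on openness of
invertibility. -/
theorem hasDerivAt_lyapunov {S : Mat n} (hS : S.PosDef) (W H : Mat n) :
    HasDerivAt (fun s : ℝ => lyapunov (S + s • W) H)
      (-lyapunov S (W * lyapunov S H + lyapunov S H * W)) 0 := by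
  have e : ∀ (s : ℝ) (X : Mat n), lyapunovLM S X + s • lyapunovLM W X =
      (S + s • W) * X + X * (S + s • W) := by
    intro s X
    rw [lyapunovLM_apply, lyapunovLM_apply, Matrix.add_mul, Matrix.mul_add, Matrix.smul_mul,
      Matrix.mul_smul, smul_add]
    abel
  obtain ⟨f', hf', hf0⟩ := exists_hasDerivAt_linear_solution (lyapunovLM S) (lyapunovLM W)
    ((Function.bijective_iff_existsUnique _).2 fun K => existsUnique_lyapunov hS K)
    (f := fun s : ℝ => lyapunov (S + s • W) H) (y := H) (fun s hs => by
      obtain ⟨X, hX⟩ := hs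
      have h := Classical.epsilon_spec
        (p := fun X : Mat n => (S + s • W) * X + X * (S + s • W) = H) ⟨X, (e s X).symm.trans hX⟩
      exact (e s _).trans h)
  have hf0 : S * f' + f' * S + (W * lyapunov (S + (0 : ℝ) • W) H +
      lyapunov (S + (0 : ℝ) • W) H * W) = 0 := hf0
  rw [zero_smul, add_zero] at hf0
  rw [← lyapunov_neg hS, lyapunov_eq_of hS (eq_neg_of_add_eq_zero_left hf0)]
  exact hf'

/-- The functional `M ↦ Re tr (M K)` as a real-linear map. -/
noncomputable def reTraceMulLM (K : Mat n) : Mat n →ₗ[ℝ] ℝ where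
  toFun := fun M => (M * K).trace.re
  map_add' := fun M N => by simp [Matrix.add_mul]
  map_smul' := fun c M => by simp

theorem deriv_bwMetric {S : Mat n} (hS : S.PosDef) (W H K : Mat n) :
    deriv (fun s : ℝ => bwMetric (S + s • W) H K) 0 =
      -(bwMetric S (W * lyapunov S H + lyapunov S H * W) K) := by
  have h := (hasDerivAt_linearMap_comp (reTraceMulLM K)
    (hasDerivAt_lyapunov hS W H)).const_mul (1 / 2 : ℝ)
  refine h.deriv.trans ?_
  change 1 / 2 * ((-lyapunov S _) * K).trace.re = -(1 / 2 * (lyapunov S _ * K).trace.re)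
  rw [Matrix.neg_mul, Matrix.trace_neg, Complex.neg_re, mul_neg]

/-- The covariant acceleration vanishes on curves with velocity `X S + S X` and acceleration
`c S + 2 X S X`. -/
theorem bwMetric_add_christoffel_eq_zero {S : Mat n} (hS : S.PosDef) (X Z : Mat n) (c : ℝ)
    (hZ : Z.trace = 0) :
    bwMetric S (c • S + (2 : ℝ) • (X * S * X)) Z +
      christoffel bwMetric S (S * X + X * S) (S * X + X * S) Z = 0 := by
  set H := S * X + X * S with hH
  have hX : lyapunov S H = X := lyapunov_eq_of hS rfl
  rw [christoffel, deriv_bwMetric hS, deriv_bwMetric hS, hX]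
  -- The Christoffel term equals `-g(HX + XH, Z) + (1/2) g(ZX + XZ, H)`. The part `S X² + X² S` of
  -- `HX + XH` is cancelled by the second summand, and `2 X S X` by the acceleration.
  have e1 : H * X + X * H = (2 : ℝ) • (X * S * X) + (S * (X * X) + (X * X) * S) := by
    rw [hH, two_smul]
    noncomm_ring
  -- The multiple of `S` in the acceleration pairs with `Z` to a multiple of `tr Z = 0`: it is
  -- normal to the trace-one slice.
  have e2 : lyapunov S (c • S) = (c / 2) • (1 : Mat n) := by
    refine lyapunov_eq_of hS ?_
    rw [Matrix.mul_smul, Matrix.smul_mul, Matrix.mul_one, Matrix.one_mul]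
    module
  have e3 : lyapunov S (S * (X * X) + (X * X) * S) = X * X := lyapunov_eq_of hS rfl
  have e4 : ((lyapunov S (Z * X + X * Z)) * H).trace = 2 * (X * X * Z).trace := by
    rw [trace_lyapunov_mul_comm hS, hX, Matrix.mul_add, Matrix.trace_add, ← Matrix.mul_assoc,
      ← Matrix.mul_assoc, Matrix.trace_mul_cycle X Z X]
    ring
  have e5 : bwMetric S (Z * X + X * Z) H = (X * X * Z).trace.re := by
    rw [bwMetric, e4, Complex.mul_re, Complex.re_ofNat, Complex.im_ofNat]
    ring
  have e6 : bwMetric S (c • S + (2 : ℝ) • (X * S * X)) Z =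
      1 / 2 * (lyapunov S ((2 : ℝ) • (X * S * X)) * Z).trace.re := by
    rw [bwMetric, lyapunov_add hS, e2, Matrix.add_mul, Matrix.smul_mul, Matrix.one_mul,
      Matrix.trace_add, Matrix.trace_smul, hZ, smul_zero, zero_add]
  have e7 : bwMetric S (H * X + X * H) Z =
      1 / 2 * (lyapunov S ((2 : ℝ) • (X * S * X)) * Z).trace.re + 1 / 2 * (X * X * Z).trace.re := by
    rw [bwMetric, e1, lyapunov_add hS, e3, Matrix.add_mul, Matrix.trace_add, Complex.add_re,
      mul_add]
  rw [e5, e6, e7]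
  ring

end Calculus

theorem isGeodesic_of_hasDerivAt {E : Type*} [NormedAddCommGroup E] [NormedSpace ℝ E]
    {M : Set E} {T : Submodule ℝ E} {g : E → E → E → ℝ} {σ v a : ℝ → E} (hσ : ContDiff ℝ ∞ σ)
    (hmem : ∀ t ∈ Set.Icc (0 : ℝ) 1, σ t ∈ M) (hv : ∀ t, HasDerivAt σ (v t) t)
    (ha : ∀ t, HasDerivAt v (a t) t)
    (h : ∀ t ∈ Set.Icc (0 : ℝ) 1, ∀ Z ∈ T,
      g (σ t) (a t) Z + christoffel g (σ t) (v t) (v t) Z = 0) :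
    IsGeodesic M T g σ := by
  refine ⟨hσ.contDiffOn, hmem, fun t ht Z hZ => ?_⟩
  have hu := uniqueDiffOn_Icc (zero_lt_one' ℝ)
  have hd : ∀ s ∈ Set.Icc (0 : ℝ) 1, derivWithin σ (Set.Icc 0 1) s = v s := fun s hs =>
    (hv s).hasDerivWithinAt.derivWithin (hu s hs)
  rw [derivWithin_congr hd (hd t ht), hd t ht, (ha t).hasDerivWithinAt.derivWithin (hu t ht)]
  exact h t ht Z hZ

/-! ### Frobenius geometry of the pencil, and horizontality -/

section Pencil

variable {n : ℕ}

theorem norm_sq_eq_trace_re (M : Mat n) : ‖M‖ ^ 2 = (M * Mᴴ).trace.re := by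
  rw [norm_eq_sqrt_trace, Real.sq_sqrt]
  exact (Complex.nonneg_iff.1 (Matrix.posSemidef_self_mul_conjTranspose M).trace_nonneg).1

theorem trace_mul_conjTranspose_self (M : Mat n) : (M * Mᴴ).trace = ((‖M‖ ^ 2 : ℝ) : ℂ) := by
  rw [norm_sq_eq_trace_re]
  refine Complex.ext rfl ?_
  exact (Complex.nonneg_iff.1 (Matrix.posSemidef_self_mul_conjTranspose M).trace_nonneg).2.symm

theorem re_trace_mul_conjTranspose_comm (A B : Mat n) :
    (B * Aᴴ).trace.re = (A * Bᴴ).trace.re := by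
  have h : (B * Aᴴ) = (A * Bᴴ)ᴴ := by
    rw [Matrix.conjTranspose_mul, Matrix.conjTranspose_conjTranspose]
  rw [h, Matrix.trace_conjTranspose, Complex.star_def, Complex.conj_re]

theorem norm_sq_smul_add_smul (A B : Mat n) (a b : ℝ) :
    ‖a • A + b • B‖ ^ 2 =
      a ^ 2 * ‖A‖ ^ 2 + b ^ 2 * ‖B‖ ^ 2 + 2 * a * b * (A * Bᴴ).trace.re := by
  have h : (a • A + b • B) * (a • A + b • B)ᴴ =
      (a ^ 2) • (A * Aᴴ) + (b ^ 2) • (B * Bᴴ) + (a * b) • (A * Bᴴ) + (a * b) • (B * Aᴴ) := by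
    simp only [Matrix.conjTranspose_add, Matrix.conjTranspose_smul, star_trivial,
      Matrix.add_mul, Matrix.mul_add, Matrix.smul_mul, Matrix.mul_smul, smul_smul, smul_add]
    module
  rw [norm_sq_eq_trace_re, h]
  simp only [Matrix.trace_add, Matrix.trace_smul, Complex.add_re, Complex.smul_re, smul_eq_mul,
    re_trace_mul_conjTranspose_comm A B, ← norm_sq_eq_trace_re]
  ring

theorem re_trace_mul_conjTranspose_pos {A B : Mat n} (hA : A.PosDef) (hAB : (A * B).PosDef)
    (hA1 : ‖A‖ = 1) : 0 < (A * Bᴴ).trace.re := by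
  -- Strict positivity of the trace fails for `n = 0`, which the unit norm excludes.
  have hne : Nonempty (Fin n) := by
    by_contra h
    rw [not_nonempty_iff] at h
    have : A = 0 := Subsingleton.elim _ _
    rw [this, norm_zero] at hA1
    exact zero_ne_one hA1
  have h := (Complex.pos_iff.1 hAB.trace_pos).1
  rwa [Matrix.trace_mul_comm, ← hA.isHermitian.eq, re_trace_mul_conjTranspose_comm] at h

theorem norm_eq_one_of_bwProj_mem {M : Mat n} (h : bwProj M ∈ densities n) : ‖M‖ = 1 := by
  have h1 : (M * Mᴴ).trace = 1 := h.2
  have h2 : ‖M‖ ^ 2 = 1 := by rw [norm_sq_eq_trace_re, h1, Complex.one_re]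
  exact (pow_eq_one_iff_of_nonneg (norm_nonneg M) two_ne_zero).1 h2

theorem bwProj_mem_densities {M : Mat n} (hM : M ∈ unitSphereGL n) : bwProj M ∈ densities n := by
  refine ⟨posDef_mul_conjTranspose hM.2, ?_⟩
  rw [bwProj, trace_mul_conjTranspose_self, hM.1]
  norm_num

theorem normalise_mem_unitSphereGL {M : Mat n} (hM : IsUnit M) (h0 : M ≠ 0) :
    ‖M‖⁻¹ • M ∈ unitSphereGL n := by
  have hn : ‖M‖ ≠ 0 := norm_ne_zero_iff.2 h0
  refine ⟨?_, ?_⟩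
  · rw [norm_smul, norm_inv, norm_norm, inv_mul_cancel₀ hn]
  · exact hM.smul (Units.mk0 _ (inv_ne_zero hn))

/-- Horizontality at a Hermitian lift, in terms of the pencil spanned by `A` and `B`. -/
theorem isHorizontal_sub_smul {A B : Mat n} (hA : A.PosDef) (hAB : (A * B).IsHermitian)
    (hA1 : ‖A‖ = 1) : IsHorizontal A (B - (A * Bᴴ).trace.re • A) := by
  have hAA : (A * Aᴴ).trace.re = 1 := by rw [← norm_sq_eq_trace_re, hA1, one_pow]
  have hd := (Matrix.isUnit_iff_isUnit_det _).1 hA.isUnit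
  have hBA : A * B = Bᴴ * A := by
    have := hAB.eq
    rw [Matrix.conjTranspose_mul, hA.isHermitian.eq] at this
    exact this.symm
  have hsub : ∀ (c : ℝ) (K : Mat n), ((B - c • A) * Kᴴ).trace.re =
      (B * Kᴴ).trace.re - c * (A * Kᴴ).trace.re := by
    intro c K
    rw [Matrix.sub_mul, Matrix.trace_sub, Complex.sub_re, Matrix.smul_mul, Matrix.trace_smul,
      Complex.smul_re, smul_eq_mul]
  refine ⟨?_, fun K hK hker => ?_⟩
  · rw [hsub, hAA, re_trace_mul_conjTranspose_comm A B, mul_one, sub_self]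
  · rw [hsub, ← re_trace_mul_conjTranspose_comm A K, hK, mul_zero, sub_zero]
    rw [fderiv_bwProj_apply, hA.isHermitian.eq] at hker
    have h1 : Kᴴ = -(A⁻¹ * K * A) := by
      have : A⁻¹ * (K * A + A * Kᴴ) = 0 := by rw [hker, Matrix.mul_zero]
      rw [Matrix.mul_add, ← Matrix.mul_assoc, ← Matrix.mul_assoc, Matrix.nonsing_inv_mul _ hd,
        Matrix.one_mul] at this
      exact eq_neg_of_add_eq_zero_right this
    -- `tr (B K*) = -tr (B A⁻¹ K A) = -tr (K A B A⁻¹)`, and `A B = B* A` turns this into `-tr (K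
    -- B*)`. The two traces have equal real parts, so both real parts vanish.
    have h2 : (B * Kᴴ).trace = -(K * Bᴴ).trace := by
      conv_lhs => rw [h1]
      rw [Matrix.mul_neg, Matrix.trace_neg, Matrix.trace_mul_comm, Matrix.mul_assoc, hBA,
        Matrix.mul_assoc, Matrix.trace_mul_comm, Matrix.mul_assoc, Matrix.mul_assoc,
        Matrix.mul_nonsing_inv _ hd, Matrix.mul_one]
    have h3 := congrArg Complex.re h2
    rw [Complex.neg_re, re_trace_mul_conjTranspose_comm B K] at h3
    linarith

end Pencil

/-! ### Great circle arcs and their projections -/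

section GreatCircle

variable {n : ℕ}

/-- The arc of the great circle from `A` to `B`, unit vectors at angle `θ`. -/
noncomputable def arc (A B : Mat n) (θ s : ℝ) : Mat n :=
  (Real.sin (θ * (1 - s)) / Real.sin θ) • A + (Real.sin (θ * s) / Real.sin θ) • B

/-- The velocity of `arc`. -/
noncomputable def arcVelocity (A B : Mat n) (θ s : ℝ) : Mat n :=
  (-(θ * Real.cos (θ * (1 - s))) / Real.sin θ) • A + (θ * Real.cos (θ * s) / Real.sin θ) • B

theorem hasDerivAt_arc (A B : Mat n) (θ s : ℝ) :
    HasDerivAt (arc A B θ) (arcVelocity A B θ s) s := by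
  have h1 : HasDerivAt (fun s : ℝ => θ * (1 - s)) (-θ) s := by
    simpa using ((hasDerivAt_id s).const_sub 1).const_mul θ
  have h2 : HasDerivAt (fun s : ℝ => θ * s) θ s := by
    simpa using (hasDerivAt_id s).const_mul θ
  refine (((h1.sin.div_const (Real.sin θ)).smul_const A).add
    ((h2.sin.div_const (Real.sin θ)).smul_const B)).congr_deriv ?_
  rw [arcVelocity]
  congr 2 <;> ring

theorem hasDerivAt_arcVelocity (A B : Mat n) (θ s : ℝ) :
    HasDerivAt (arcVelocity A B θ) (-(θ ^ 2) • arc A B θ s) s := by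
  have h1 : HasDerivAt (fun s : ℝ => θ * (1 - s)) (-θ) s := by
    simpa using ((hasDerivAt_id s).const_sub 1).const_mul θ
  have h2 : HasDerivAt (fun s : ℝ => θ * s) θ s := by
    simpa using (hasDerivAt_id s).const_mul θ
  refine ((((h1.cos.const_mul θ).neg.div_const (Real.sin θ)).smul_const A).add
    (((h2.cos.const_mul θ).div_const (Real.sin θ)).smul_const B)).congr_deriv ?_
  rw [arc, smul_add, smul_smul, smul_smul]
  congr 2 <;> ring

theorem contDiff_arc (A B : Mat n) (θ : ℝ) : ContDiff ℝ ∞ (arc A B θ) := by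
  have h1 : ContDiff ℝ ∞ fun s : ℝ => Real.sin (θ * (1 - s)) / Real.sin θ :=
    (Real.contDiff_sin.comp (contDiff_const.mul (contDiff_const.sub contDiff_id))).div_const _
  have h2 : ContDiff ℝ ∞ fun s : ℝ => Real.sin (θ * s) / Real.sin θ :=
    (Real.contDiff_sin.comp (contDiff_const.mul contDiff_id)).div_const _
  exact (h1.smul contDiff_const).add (h2.smul contDiff_const)

theorem norm_arc {A B : Mat n} {θ : ℝ} (hA1 : ‖A‖ = 1) (hB1 : ‖B‖ = 1)
    (hθ : Real.cos θ = (A * Bᴴ).trace.re) (hs : Real.sin θ ≠ 0) (s : ℝ) :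
    ‖arc A B θ s‖ = 1 := by
  refine (pow_eq_one_iff_of_nonneg (norm_nonneg _) two_ne_zero).1 ?_
  rw [arc, norm_sq_smul_add_smul, hA1, hB1, ← hθ, mul_sub, mul_one, Real.sin_sub]
  field_simp
  linear_combination (Real.sin θ ^ 2) * Real.sin_sq_add_cos_sq (θ * s) +
    (-Real.sin (θ * s) ^ 2) * Real.sin_sq_add_cos_sq θ

theorem isUnit_arc {A B : Mat n} {θ s : ℝ} (hA : A.PosDef) (hAB : (A * B).PosDef)
    (hθ0 : 0 < θ) (hθ1 : θ < Real.pi / 2) (hs : s ∈ Set.Icc (0 : ℝ) 1) :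
    IsUnit (arc A B θ s) := by
  have hsin : 0 < Real.sin θ := Real.sin_pos_of_pos_of_lt_pi hθ0 (by linarith [Real.pi_pos])
  have hnn : ∀ x ∈ Set.Icc (0 : ℝ) 1, 0 ≤ Real.sin (θ * x) := fun x hx =>
    Real.sin_nonneg_of_nonneg_of_le_pi (mul_nonneg hθ0.le hx.1)
      (by nlinarith [Real.pi_pos, hx.1, hx.2])
  have hs' : 1 - s ∈ Set.Icc (0 : ℝ) 1 := ⟨by linarith [hs.2], by linarith [hs.1]⟩
  refine isUnit_smul_add_smul hA hAB (div_nonneg (hnn _ hs') hsin.le)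
    (div_nonneg (hnn _ hs) hsin.le) ?_
  rw [← add_div]
  refine div_pos ?_ hsin
  -- At `s = 0` the coefficient of `B` vanishes and that of `A` carries the positivity; for `s > 0`
  -- the coefficient of `B` is positive.
  rcases hs.1.eq_or_lt with h | h
  · rw [← h]
    simpa using hsin
  · exact add_pos_of_nonneg_of_pos (hnn _ hs')
      (Real.sin_pos_of_pos_of_lt_pi (mul_pos hθ0 h) (by nlinarith [Real.pi_pos, hs.2]))

/-- From `C'' = -θ² C` one gets `(C C*)'' = -2θ² C C* + 2 C' C'*`, the shape needed for
`bwMetric_add_christoffel_eq_zero` once `C' = X C`. -/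
theorem hasDerivAt_bwProj_arc_velocity (A B : Mat n) (θ s : ℝ) :
    HasDerivAt (fun s => arcVelocity A B θ s * (arc A B θ s)ᴴ + arc A B θ s *
        (arcVelocity A B θ s)ᴴ)
      ((-(2 * θ ^ 2)) • bwProj (arc A B θ s) +
        (2 : ℝ) • (arcVelocity A B θ s * (arcVelocity A B θ s)ᴴ)) s := by
  have hC := hasDerivAt_arc A B θ s
  have hD := hasDerivAt_arcVelocity A B θ s
  refine ((hasDerivAt_matrix_mul hD (hasDerivAt_conjTranspose hC)).add
    (hasDerivAt_matrix_mul hC (hasDerivAt_conjTranspose hD))).congr_deriv ?_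
  rw [bwProj, Matrix.conjTranspose_smul, star_trivial, Matrix.smul_mul, Matrix.mul_smul]
  module

theorem isHermitian_arc_velocity {A B : Mat n} (hA : A.IsHermitian) (hAB : (A * B).IsHermitian)
    (θ s : ℝ) : ((arc A B θ s)ᴴ * arcVelocity A B θ s).IsHermitian :=
  isHermitian_conjTranspose_mul_pencil hA hAB _ _ _ _

/-- The projection of a horizontal great circle arc is a geodesic. -/
theorem isGeodesic_bwProj_arc {A B : Mat n} {θ : ℝ} (hA : A.PosDef) (hAB : (A * B).PosDef)
    (hA1 : ‖A‖ = 1) (hB1 : ‖B‖ = 1) (hθ : Real.cos θ = (A * Bᴴ).trace.re) (hθ0 : 0 < θ)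
    (hθ1 : θ < Real.pi / 2) :
    IsGeodesic (densities n) (densityTangent n) bwMetric (fun s => bwProj (arc A B θ s)) := by
  have hsin : 0 < Real.sin θ := Real.sin_pos_of_pos_of_lt_pi hθ0 (by linarith [Real.pi_pos])
  have hmem : ∀ s ∈ Set.Icc (0 : ℝ) 1, arc A B θ s ∈ unitSphereGL n := fun s hs =>
    ⟨norm_arc hA1 hB1 hθ hsin.ne' s, isUnit_arc hA hAB hθ0 hθ1 hs⟩
  refine isGeodesic_of_hasDerivAt (contDiff_bwProj.comp (contDiff_arc A B θ))
    (fun s hs => bwProj_mem_densities (hmem s hs))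
    (fun s => hasDerivAt_bwProj_comp (hasDerivAt_arc A B θ s))
    (hasDerivAt_bwProj_arc_velocity A B θ) fun s hs Z hZ => ?_
  have hC := (hmem s hs).2
  -- `X = D C⁻¹` is Hermitian, so `D = X C` and `D* = C* X`; this expresses velocity and
  -- acceleration through `S = C C*` and `X`.
  have hX := isHermitian_mul_inv hC
    (isHermitian_arc_velocity hA.isHermitian hAB.isHermitian θ s)
  have hdet := (Matrix.isUnit_iff_isUnit_det _).1 hC
  have hXC : arcVelocity A B θ s * (arc A B θ s)⁻¹ * arc A B θ s = arcVelocity A B θ s := by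
    rw [Matrix.mul_assoc, Matrix.nonsing_inv_mul _ hdet, Matrix.mul_one]
  generalize hXdef : arcVelocity A B θ s * (arc A B θ s)⁻¹ = X at hX hXC
  generalize arcVelocity A B θ s = D at *
  generalize arc A B θ s = C at *
  have hCX : Cᴴ * X = Dᴴ := by
    rw [← hXC, Matrix.conjTranspose_mul, hX.eq]
  have h1 : D * Cᴴ + C * Dᴴ = bwProj C * X + X * bwProj C := by
    rw [bwProj, Matrix.mul_assoc, hCX, ← Matrix.mul_assoc, hXC, add_comm]
  have h2 : D * Dᴴ = X * bwProj C * X := by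
    rw [bwProj, ← Matrix.mul_assoc, hXC, Matrix.mul_assoc, hCX]
  rw [h1, h2]
  exact bwMetric_add_christoffel_eq_zero (posDef_mul_conjTranspose hC) X Z _ hZ.2

theorem isGeodesic_const {ρ : Mat n} (hρ : ρ ∈ densities n) :
    IsGeodesic (densities n) (densityTangent n) bwMetric (fun _ => ρ) := by
  refine isGeodesic_of_hasDerivAt contDiff_const (fun _ _ => hρ)
    (fun s => hasDerivAt_const s ρ) (fun s => hasDerivAt_const s (0 : Mat n)) fun s _ Z hZ => ?_
  have h := bwMetric_add_christoffel_eq_zero hρ.1 0 Z 0 hZ.2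
  simpa using h

end GreatCircle

/-! ### From the chord parameter to the angle along the arc -/

section Reparametrisation

variable {n : ℕ} {θ : ℝ}

/-- The angle, as a fraction of `θ`, at which the chord parametrised by `t` is seen. -/
noncomputable def arcParam (θ t : ℝ) : ℝ :=
  θ⁻¹ * Real.arctan (t * Real.sin θ / (1 - t + t * Real.cos θ))

theorem chord_denom_pos {c t : ℝ} (hc : 0 < c) (ht : t ∈ Set.Icc (0 : ℝ) 1) :
    0 < 1 - t + t * c := by
  rcases ht.1.eq_or_lt with rfl | h
  · norm_num
  · nlinarith [ht.2, mul_pos h hc]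

theorem arcParam_zero (θ : ℝ) : arcParam θ 0 = 0 := by simp [arcParam]

theorem arcParam_one (hθ0 : 0 < θ) (hθ1 : θ < Real.pi / 2) : arcParam θ 1 = 1 := by
  rw [arcParam, sub_self, zero_add, one_mul, one_mul, ← Real.tan_eq_sin_div_cos,
    Real.arctan_tan (by linarith) hθ1, inv_mul_cancel₀ hθ0.ne']

theorem contDiffOn_arcParam (hc : 0 < Real.cos θ) :
    ContDiffOn ℝ ∞ (arcParam θ) (Set.Icc 0 1) := by
  have h1 : ContDiff ℝ ∞ fun t : ℝ => t * Real.sin θ := contDiff_id.mul contDiff_const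
  have h2 : ContDiff ℝ ∞ fun t : ℝ => 1 - t + t * Real.cos θ :=
    (contDiff_const.sub contDiff_id).add (contDiff_id.mul contDiff_const)
  exact contDiffOn_const.mul (Real.contDiff_arctan.comp_contDiffOn
    (h1.contDiffOn.div h2.contDiffOn fun t ht => (chord_denom_pos hc ht).ne'))

theorem derivWithin_arcParam_pos (hθ0 : 0 < θ) (hθ1 : θ < Real.pi / 2) {t : ℝ}
    (ht : t ∈ Set.Icc (0 : ℝ) 1) : 0 < derivWithin (arcParam θ) (Set.Icc 0 1) t := by
  have hsin : 0 < Real.sin θ := Real.sin_pos_of_pos_of_lt_pi hθ0 (by linarith [Real.pi_pos])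
  have hcos : 0 < Real.cos θ := Real.cos_pos_of_mem_Ioo ⟨by linarith, hθ1⟩
  have hd := chord_denom_pos hcos ht
  have h1 : HasDerivAt (fun t : ℝ => t * Real.sin θ) (Real.sin θ) t := by
    simpa using (hasDerivAt_id t).mul_const (Real.sin θ)
  have h2 : HasDerivAt (fun t : ℝ => 1 - t + t * Real.cos θ) (-1 + 1 * Real.cos θ) t :=
    ((hasDerivAt_id t).const_sub 1).add ((hasDerivAt_id t).mul_const (Real.cos θ))
  -- The numerator of the quotient rule collapses to `sin θ`, which gives the sign of the
  -- derivative.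
  have h3 : HasDerivAt (fun t : ℝ => t * Real.sin θ / (1 - t + t * Real.cos θ))
      (Real.sin θ / (1 - t + t * Real.cos θ) ^ 2) t := by
    refine (h1.div h2 hd.ne').congr_deriv ?_
    congr 1
    ring
  have h4 := (h3.arctan.const_mul θ⁻¹).hasDerivWithinAt.derivWithin
    (uniqueDiffOn_Icc (zero_lt_one' ℝ) t ht)
  refine lt_of_lt_of_eq ?_ h4.symm
  positivity

/-- The normalised chord from `A` to `B` runs along the great circle arc. -/
theorem normalised_chord_eq_arc {A B : Mat n} (hA1 : ‖A‖ = 1) (hB1 : ‖B‖ = 1)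
    (hθ : Real.cos θ = (A * Bᴴ).trace.re) (hθ0 : 0 < θ) (hθ1 : θ < Real.pi / 2) {t : ℝ}
    (ht : t ∈ Set.Icc (0 : ℝ) 1) :
    ‖(1 - t) • A + t • B‖⁻¹ • ((1 - t) • A + t • B) = arc A B θ (arcParam θ t) := by
  have hsin : 0 < Real.sin θ := Real.sin_pos_of_pos_of_lt_pi hθ0 (by linarith [Real.pi_pos])
  have hcos : 0 < Real.cos θ := Real.cos_pos_of_mem_Ioo ⟨by linarith, hθ1⟩
  have hd := chord_denom_pos hcos ht
  have hN := norm_sq_smul_add_smul A B (1 - t) t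
  rw [hA1, hB1, ← hθ] at hN
  have hN0 := norm_nonneg ((1 - t) • A + t • B)
  rw [arc, smul_add, smul_smul, smul_smul]
  generalize ‖(1 - t) • A + t • B‖ = N at hN hN0 ⊢
  set d := 1 - t + t * Real.cos θ with hd_def
  -- In the plane of `A` and `B`, with `A` as first vector of an orthonormal frame, the chord point
  -- has coordinates `(d, t sin θ)`. Its polar angle is `θ * arcParam θ t`.
  have hN' : N ^ 2 = d ^ 2 + (t * Real.sin θ) ^ 2 := by
    rw [hN, hd_def, mul_pow, Real.sin_sq]
    ring
  have hNpos : 0 < N := by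
    rcases hN0.eq_or_lt with h | h
    · rw [← h] at hN'
      nlinarith [sq_nonneg (t * Real.sin θ), pow_pos hd 2]
    · exact h
  have hsqrt : Real.sqrt (1 + (t * Real.sin θ / d) ^ 2) = N / d := by
    rw [Real.sqrt_eq_iff_mul_self_eq (by positivity) (by positivity)]
    field_simp
    linarith
  have hθφ : θ * arcParam θ t = Real.arctan (t * Real.sin θ / d) := by
    rw [arcParam, mul_inv_cancel_left₀ hθ0.ne']
  have hsinφ : Real.sin (θ * arcParam θ t) = t * Real.sin θ / N := by
    rw [hθφ, Real.sin_arctan, hsqrt]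
    field_simp
  have hcosφ : Real.cos (θ * arcParam θ t) = d / N := by
    rw [hθφ, Real.cos_arctan, hsqrt]
    field_simp
  rw [mul_sub θ, mul_one θ, Real.sin_sub, hsinφ, hcosφ, hd_def]
  congr 2 <;> field_simp
  ring

end Reparametrisation

/-! ### The normalised chord: geodesic property and initial velocity -/

section Chord

variable {n : ℕ}

theorem isUnnormalisedBWGeodesic_chord {A B : Mat n} (hA : A.PosDef) (hAB : (A * B).PosDef)
    (hA1 : ‖A‖ = 1) (hB1 : ‖B‖ = 1) :
    IsUnnormalisedBWGeodesic (bwProj A) (bwProj B)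
      (fun t => bwProj (‖(1 - t) • A + t • B‖⁻¹ • ((1 - t) • A + t • B))) := by
  refine ⟨by simp [hA1], by simp [hB1], ?_⟩
  have hc0 := re_trace_mul_conjTranspose_pos hA hAB hA1
  -- `‖A - B‖² = 2 - 2 Re tr (A B*)` gives both the bound by `1` and, in the equality case, `B = A`.
  have hdist := norm_sq_smul_add_smul A B 1 (-1)
  rw [hA1, hB1] at hdist
  have hc1 : (A * Bᴴ).trace.re ≤ 1 := by
    nlinarith [sq_nonneg ‖(1 : ℝ) • A + (-1 : ℝ) • B‖]
  rcases hc1.eq_or_lt with hc | hc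
  · have hBA : B = A := by
      rw [hc] at hdist
      have h : (1 : ℝ) • A + (-1 : ℝ) • B = 0 := by
        rw [← norm_eq_zero, ← sq_eq_zero_iff, hdist]
        norm_num
      rw [one_smul, neg_one_smul, ← sub_eq_add_neg, sub_eq_zero] at h
      exact h.symm
    subst hBA
    -- Here `θ = 0` and the arc formula would divide by `sin 0`, so a constant geodesic is used.
    refine ⟨fun _ => bwProj B, id, isGeodesic_const (bwProj_mem_densities ⟨hB1, hA.isUnit⟩),
      contDiffOn_id, rfl, rfl, fun t ht => ?_, fun t _ => ?_⟩
    · rw [derivWithin_id _ _ (uniqueDiffOn_Icc (zero_lt_one' ℝ) t ht)]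
      exact one_pos
    · have h : (1 - t) • B + t • B = B := by module
      simp only [h, hB1, inv_one, one_smul]
  · set θ := Real.arccos (A * Bᴴ).trace.re with hθ_def
    have hθ : Real.cos θ = (A * Bᴴ).trace.re := Real.cos_arccos (by linarith) hc1
    have hθ0 : 0 < θ := Real.arccos_pos.2 hc
    have hθ1 : θ < Real.pi / 2 := Real.arccos_lt_pi_div_two.2 hc0
    refine ⟨_, arcParam θ, isGeodesic_bwProj_arc hA hAB hA1 hB1 hθ hθ0 hθ1,
      contDiffOn_arcParam (hθ ▸ hc0), arcParam_zero θ, arcParam_one hθ0 hθ1,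
      fun t ht => derivWithin_arcParam_pos hθ0 hθ1 ht, fun t ht => ?_⟩
    exact congrArg bwProj (normalised_chord_eq_arc hA1 hB1 hθ hθ0 hθ1 ht)

/-- With `c = Re tr (A B*)`, the squared norm has derivative `2c - 2` at `0`, so its inverse square
root has derivative `1 - c`, and `(1 - c) A + (B - A) = B - c A`. -/
theorem hasDerivAt_normalised_chord {A B : Mat n} (hA1 : ‖A‖ = 1) (hB1 : ‖B‖ = 1) :
    HasDerivAt (fun t : ℝ => ‖(1 - t) • A + t • B‖⁻¹ • ((1 - t) • A + t • B))
      (B - (A * Bᴴ).trace.re • A) 0 := by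
  set c := (A * Bᴴ).trace.re with hc
  have hnorm : ∀ t : ℝ, ‖(1 - t) • A + t • B‖ =
      Real.sqrt ((1 - t) ^ 2 + t ^ 2 + 2 * (1 - t) * t * c) := by
    intro t
    rw [← Real.sqrt_sq (norm_nonneg _), norm_sq_smul_add_smul, hA1, hB1, one_pow, mul_one, mul_one]
  have hid := hasDerivAt_id (0 : ℝ)
  have h1 := hid.const_sub 1
  have hγ : HasDerivAt (fun t : ℝ => (1 - t) • A + t • B) (B - A) 0 := by
    refine ((h1.smul_const A).add (hid.smul_const B)).congr_deriv ?_
    module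
  have hq : HasDerivAt (fun t : ℝ => (1 - t) ^ 2 + t ^ 2 + 2 * (1 - t) * t * c) (2 * c - 2) 0 := by
    refine (((h1.pow 2).add (hid.pow 2)).add
      (((h1.const_mul 2).mul hid).mul_const c)).congr_deriv ?_
    simp
    ring
  have hs : HasDerivAt (fun t : ℝ => ‖(1 - t) • A + t • B‖⁻¹) (1 - c) 0 := by
    simp only [hnorm]
    refine ((hq.sqrt (by norm_num)).inv (by norm_num)).congr_deriv ?_
    norm_num
    ring
  refine (hs.smul hγ).congr_deriv ?_
  simp only [sub_zero, one_smul, zero_smul, add_zero, hA1, inv_one]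
  module

theorem startsHorizontally_normalised_chord {A B : Mat n} (hA : A.PosDef)
    (hAB : (A * B).IsHermitian) (hA1 : ‖A‖ = 1) (hB1 : ‖B‖ = 1) :
    StartsHorizontally
      (fun t : ℝ => ‖(1 - t) • A + t • B‖⁻¹ • ((1 - t) • A + t • B)) := by
  have hderiv := hasDerivAt_normalised_chord hA1 hB1
  have hdiff := hderiv.differentiableAt
  have hd := hderiv.deriv
  refine ⟨hdiff, ?_⟩
  have h0 : ‖(1 - (0 : ℝ)) • A + (0 : ℝ) • B‖⁻¹ • ((1 - (0 : ℝ)) • A + (0 : ℝ) • B) = A := by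
    rw [sub_zero, one_smul, zero_smul, add_zero, hA1, inv_one, one_smul]
  have h := isHorizontal_sub_smul hA hAB hA1
  rw [← hd] at h
  change IsHorizontal (‖(1 - (0 : ℝ)) • A + (0 : ℝ) • B‖⁻¹ • _) _
  rw [h0]
  exact h

end Chord

end BuresWasserstein

theorem mainTheorem4 (n : ℕ) (ρ₁ ρ₂ : BuresWasserstein.Mat n)
    (h₁ : ρ₁ ∈ BuresWasserstein.densities n) (h₂ : ρ₂ ∈ BuresWasserstein.densities n) :
    BuresWasserstein.IsUnnormalisedBWGeodesic ρ₁ ρ₂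
        (fun t => BuresWasserstein.bwProj (BuresWasserstein.normalisedSegment ρ₁ ρ₂ t)) ∧
    (∀ t ∈ Set.Icc (0 : ℝ) 1, BuresWasserstein.segment ρ₁ ρ₂ t ≠ 0 ∧
      BuresWasserstein.normalisedSegment ρ₁ ρ₂ t ∈ BuresWasserstein.unitSphereGL n) ∧
    BuresWasserstein.StartsHorizontally (BuresWasserstein.normalisedSegment ρ₁ ρ₂) := by
  have hA := BuresWasserstein.posDef_msqrt h₁.1
  have hAB := BuresWasserstein.posDef_msqrt_mul_lift h₁.1 h₂.1
  have hpA := BuresWasserstein.bwProj_msqrt h₁.1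
  have hpB := BuresWasserstein.bwProj_lift h₁.1 h₂.1
  have hA1 := BuresWasserstein.norm_eq_one_of_bwProj_mem (hpA.symm ▸ h₁)
  have hB1 := BuresWasserstein.norm_eq_one_of_bwProj_mem (hpB.symm ▸ h₂)
  have hc0 := BuresWasserstein.re_trace_mul_conjTranspose_pos hA hAB hA1
  have hunit : ∀ t ∈ Set.Icc (0 : ℝ) 1, IsUnit (BuresWasserstein.segment ρ₁ ρ₂ t) := fun t ht =>
    BuresWasserstein.isUnit_smul_add_smul hA hAB (sub_nonneg.2 ht.2) ht.1 (by simp)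
  have hne : ∀ t ∈ Set.Icc (0 : ℝ) 1, BuresWasserstein.segment ρ₁ ρ₂ t ≠ 0 := by
    intro t ht h0
    -- In the zero ring `0` is a unit, so invertibility alone does not give `≠ 0`; the positive
    -- trace excludes `ρ₁^{1/2} = 0`.
    have hnt : Nontrivial (BuresWasserstein.Mat n) := by
      refine ⟨⟨BuresWasserstein.msqrt ρ₁, 0, fun h => ?_⟩⟩
      rw [h, Matrix.zero_mul, Matrix.trace_zero, Complex.zero_re] at hc0
      exact hc0.false
    exact (hunit t ht).ne_zero h0
  refine ⟨?_, fun t ht => ⟨hne t ht,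
    BuresWasserstein.normalise_mem_unitSphereGL (hunit t ht) (hne t ht)⟩,
    BuresWasserstein.startsHorizontally_normalised_chord hA hAB.isHermitian hA1 hB1⟩
  have h := BuresWasserstein.isUnnormalisedBWGeodesic_chord hA hAB hA1 hB1
  rw [hpA, hpB] at h
  exact h
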